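/- Let $n \ge 2$ and let $$\mathrm{VG}_n=\mathbb{Q}[x_{ij} : 1\le i\ne j\le n+1]\,/\,\langle x_{ij}^2,\; x_{ij}+x_{ji},\; x_{ij}x_{jk}+x_{jk}x_{ki}+x_{ki}x_{ij}\rangle \qquad (i,j,k \text{ pairwise distinct})$$ be the (rational) Varchenko--Gel'fand ring of the braid arrangement $A_n=\{z_i=z_j : 1\le i<j\le n+1\}$, on which the symmetric group $S_{n+1}$ acts by ring automorphisms with $\sigma\cdot x_{ij}=x_{\sigma(i)\sigma(j)}$. Fix a coordinate $c\in\{1,\dots,n+1\}$ (for instance $c=n+1$ or $c=1$), let $S_n\subset S_{n+1}$ be the subgroup of permutations fixing $c$, and let $\mathrm{VG}_n^{S_n}$ be the subring of $S_n$-invariant elements. Then there is an isomorphism of $\mathbb{Q}$-algebras $$\mathbb{Q}[z]/\langle z^{n+1}\rangle\;\cong\;\mathrm{VG}_n^{S_n}$$ that sends $z$ to the element $\sum_{i\ne c}x_{c,i}$. -/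

import Mathlib

open Polynomial

/-- The index set of the variables `x_{ij}`: ordered pairs of distinct elements of an
`(n + 1)`-element set. -/
abbrev BraidIndex (n : ℕ) : Type := {p : Fin (n + 1) × Fin (n + 1) // p.1 ≠ p.2}

namespace BraidIndex

/-- A permutation of the coordinates permutes the two subscripts simultaneously. -/
def perm {n : ℕ} (σ : Equiv.Perm (Fin (n + 1))) (p : BraidIndex n) : BraidIndex n :=
  ⟨(σ p.1.1, σ p.1.2), fun h => p.2 (σ.injective h)⟩

end BraidIndex

namespace VGBraid

/-- The variable `x_{ij}` (`i ≠ j`) of the polynomial ring. -/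
noncomputable def var {n : ℕ} (i j : Fin (n + 1)) (h : i ≠ j) : MvPolynomial (BraidIndex n) ℚ :=
  MvPolynomial.X ⟨(i, j), h⟩

/-- The defining relations: `x_{ij}^2`, `x_{ij} + x_{ji}` for `i ≠ j`, and
`x_{ij} x_{jk} + x_{jk} x_{ki} + x_{ki} x_{ij}` for pairwise distinct `i, j, k`. -/
inductive Rel (n : ℕ) : MvPolynomial (BraidIndex n) ℚ → Prop
  | sq (i j : Fin (n + 1)) (h : i ≠ j) : Rel n (var i j h ^ 2)
  | antisymm (i j : Fin (n + 1)) (h : i ≠ j) : Rel n (var i j h + var j i h.symm)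
  | triangle (i j k : Fin (n + 1)) (hij : i ≠ j) (hjk : j ≠ k) (hki : k ≠ i) :
      Rel n (var i j hij * var j k hjk + var j k hjk * var k i hki + var k i hki * var i j hij)

/-- The ideal generated by the defining relations. -/
noncomputable def relIdeal (n : ℕ) : Ideal (MvPolynomial (BraidIndex n) ℚ) :=
  Ideal.span {f | Rel n f}

end VGBraid

/-- The Varchenko–Gel'fand ring (with rational coefficients) of the braid arrangement `A_n`
in `n + 1` coordinates. -/
def VGBraid (n : ℕ) : Type := MvPolynomial (BraidIndex n) ℚ ⧸ VGBraid.relIdeal n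

namespace VGBraid

noncomputable instance (n : ℕ) : CommRing (VGBraid n) :=
  inferInstanceAs (CommRing (MvPolynomial (BraidIndex n) ℚ ⧸ relIdeal n))

noncomputable instance (n : ℕ) : Algebra ℚ (VGBraid n) :=
  inferInstanceAs (Algebra ℚ (MvPolynomial (BraidIndex n) ℚ ⧸ relIdeal n))

/-- The quotient map from the polynomial ring. -/
noncomputable def mk (n : ℕ) : MvPolynomial (BraidIndex n) ℚ →ₐ[ℚ] VGBraid n :=
  Ideal.Quotient.mkₐ ℚ (relIdeal n)

/-- The generator `x_{ij}` of the Varchenko–Gel'fand ring. -/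
noncomputable def x {n : ℕ} (i j : Fin (n + 1)) (h : i ≠ j) : VGBraid n :=
  mk n (var i j h)

theorem rename_rel {n : ℕ} (σ : Equiv.Perm (Fin (n + 1))) {f : MvPolynomial (BraidIndex n) ℚ}
    (hf : Rel n f) : Rel n (MvPolynomial.rename (BraidIndex.perm σ) f) := by
  cases hf with
  | sq i j h =>
    simpa [var, BraidIndex.perm] using Rel.sq (σ i) (σ j) (σ.injective.ne h)
  | antisymm i j h =>
    simpa [var, BraidIndex.perm] using Rel.antisymm (σ i) (σ j) (σ.injective.ne h)
  | triangle i j k hij hjk hki =>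
    simpa [var, BraidIndex.perm] using Rel.triangle (σ i) (σ j) (σ k)
      (σ.injective.ne hij) (σ.injective.ne hjk) (σ.injective.ne hki)

/-- The algebra endomorphism `x_{ij} ↦ x_{σ(i) σ(j)}` induced by a permutation `σ`. -/
noncomputable def permHom {n : ℕ} (σ : Equiv.Perm (Fin (n + 1))) : VGBraid n →ₐ[ℚ] VGBraid n :=
  Ideal.Quotient.liftₐ (relIdeal n) ((mk n).comp (MvPolynomial.rename (BraidIndex.perm σ))) (by
    intro a ha
    have hle : relIdeal n ≤
        RingHom.ker ((mk n).comp (MvPolynomial.rename (BraidIndex.perm σ))) := by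
      refine Ideal.span_le.2 fun f hf => ?_
      exact Ideal.Quotient.eq_zero_iff_mem.2 (Ideal.subset_span (rename_rel σ hf))
    exact hle ha)

theorem permHom_mk {n : ℕ} (σ : Equiv.Perm (Fin (n + 1))) (f : MvPolynomial (BraidIndex n) ℚ) :
    permHom σ (mk n f) = mk n (MvPolynomial.rename (BraidIndex.perm σ) f) := rfl

theorem mk_surjective (n : ℕ) : Function.Surjective (mk n) :=
  Ideal.Quotient.mkₐ_surjective ℚ (relIdeal n)

/-- The symmetric group on the `n + 1` coordinates acts on the Varchenko–Gel'fand ring by ring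
automorphisms permuting the subscripts: `σ • x_{ij} = x_{σ(i) σ(j)}`. -/
noncomputable instance (n : ℕ) : MulSemiringAction (Equiv.Perm (Fin (n + 1))) (VGBraid n) where
  smul σ a := permHom σ a
  one_smul a := by
    obtain ⟨f, rfl⟩ := mk_surjective n a
    change permHom 1 (mk n f) = mk n f
    rw [permHom_mk]
    exact congrArg (mk n) (MvPolynomial.rename_id_apply f)
  mul_smul σ τ a := by
    obtain ⟨f, rfl⟩ := mk_surjective n a
    change permHom (σ * τ) (mk n f) = permHom σ (permHom τ (mk n f))
    rw [permHom_mk, permHom_mk, permHom_mk, MvPolynomial.rename_rename]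
    rfl
  smul_zero σ := map_zero (permHom σ)
  smul_add σ := map_add (permHom σ)
  smul_one σ := map_one (permHom σ)
  smul_mul σ := map_mul (permHom σ)

theorem smul_x {n : ℕ} (σ : Equiv.Perm (Fin (n + 1))) (i j : Fin (n + 1)) (h : i ≠ j) :
    σ • x i j h = x (σ i) (σ j) (σ.injective.ne h) := by
  change permHom σ (mk n (var i j h)) = mk n (var (σ i) (σ j) (σ.injective.ne h))
  rw [permHom_mk]
  simp [var, BraidIndex.perm]

/-- The subring (a `ℚ`-subalgebra) of elements of the Varchenko–Gel'fand ring invariant under all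
permutations of the `n + 1` coordinates that fix the coordinate `c`; these permutations form a
copy of the symmetric group `S_n`. -/
def invariants (n : ℕ) (c : Fin (n + 1)) : Subalgebra ℚ (VGBraid n) where
  carrier := {a | ∀ σ ∈ MulAction.stabilizer (Equiv.Perm (Fin (n + 1))) c, σ • a = a}
  mul_mem' ha hb σ hσ := by rw [smul_mul', ha σ hσ, hb σ hσ]
  add_mem' ha hb σ hσ := by rw [smul_add, ha σ hσ, hb σ hσ]
  algebraMap_mem' r σ _ := (permHom σ).commutes r

/-- The orbit sum `z = ∑_{i ≠ c} x_{ci}`. -/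
noncomputable def orbitSum (n : ℕ) (c : Fin (n + 1)) : VGBraid n :=
  ∑ i : {i : Fin (n + 1) // i ≠ c}, x c i i.2.symm

end VGBraid

namespace VGBraid

/-! ### Generators and star identities -/

open Finset

variable {n : ℕ}

/-! Averaging over `S_n` identifies invariants with coinvariants, so it can be checked modulo the
span of all b - σ • b that the powers of the orbit sum z span the invariants.

Call ∏_{i ∈ S} x_{ci} a star with centre c. The triangle relation has two consequences: a star at w
is the sum, over its leaves v, of the star recentred at v and hung from w (`prod_gen_eq_sum`); and
the stars on a fixed vertex set, one per centre, sum to zero (`sum_prod_erase_eq_zero`). By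
induction on the vertex set they reduce every element, modulo permutations of the coordinates other
than c, to stars at c (`genAlg_insert_le_coinvKer_sup`). Stars at c of equal size are conjugate, so
each is congruent to a rational multiple of a power of z (`exists_prod_gen_sub_smul_pow_mem`).

For the kernel, x_{ci}^2 = 0 gives z^(n+1) = 0 and z^n = n! ∏ x_{ci}. The latter is nonzero because
x_{ij} ↦ y_j (i < j) defines a map to a ring of square-zero variables
(`exists_algHom_of_sq_eq_zero`). -/

/-- The generator `x_{ij}`, extended by `0` to the diagonal. -/
noncomputable def gen (i j : Fin (n + 1)) : VGBraid n :=
  if h : i ≠ j then x i j h else 0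

theorem mk_eq_zero_of_rel {f : MvPolynomial (BraidIndex n) ℚ} (hf : Rel n f) : mk n f = 0 :=
  Ideal.Quotient.eq_zero_iff_mem.2 (Ideal.subset_span hf)

theorem gen_of_ne {i j : Fin (n + 1)} (h : i ≠ j) : gen i j = mk n (var i j h) :=
  dif_pos h

@[simp]
theorem gen_self (i : Fin (n + 1)) : gen i i = 0 := by simp [gen]

theorem gen_swap (i j : Fin (n + 1)) : gen j i = -gen i j := by
  by_cases h : i = j
  · subst h; simp
  · rw [gen_of_ne h, gen_of_ne (Ne.symm h), eq_neg_iff_add_eq_zero, add_comm, ← map_add]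
    exact mk_eq_zero_of_rel (Rel.antisymm i j h)

theorem gen_sq (i j : Fin (n + 1)) : gen i j ^ 2 = 0 := by
  by_cases h : i = j
  · subst h; simp
  · rw [gen_of_ne h, ← map_pow]
    exact mk_eq_zero_of_rel (Rel.sq i j h)

/-- The triangle relation for distinct indices; on the diagonals it degenerates to the square
relation, so no distinctness is needed. -/
theorem gen_mul_gen (w v t : Fin (n + 1)) :
    gen w v * gen w t = gen w v * gen v t + gen w t * gen t v := by
  by_cases h₁ : w = v
  · subst h₁
    have := gen_sq w t
    rw [gen_swap w t, gen_self]
    linear_combination this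
  by_cases h₂ : v = t
  · subst h₂
    have := gen_sq w v
    rw [gen_self]
    linear_combination this
  by_cases h₃ : t = w
  · subst h₃
    have := gen_sq t v
    rw [gen_swap t v, gen_self]
    linear_combination this
  have h := mk_eq_zero_of_rel (Rel.triangle w v t h₁ h₂ h₃)
  simp only [map_add, map_mul, ← gen_of_ne] at h
  rw [gen_swap w t, gen_swap t v] at h
  rw [gen_swap t v]
  linear_combination -h

theorem smul_gen (σ : Equiv.Perm (Fin (n + 1))) (i j : Fin (n + 1)) :
    σ • gen i j = gen (σ i) (σ j) := by
  by_cases h : i = j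
  · subst h; simp
  · have h' : σ i ≠ σ j := σ.injective.ne h
    simp only [gen, ne_eq, h, h', not_false_eq_true, dite_true, smul_x]

theorem smul_algebraMap_smul (σ : Equiv.Perm (Fin (n + 1))) (r : ℚ) (a : VGBraid n) :
    σ • (r • a) = r • σ • a :=
  map_smul (permHom σ) r a

/-- Peel off a leaf t, expand the rest about w, and apply `gen_mul_gen` to x_{wv} x_{wt}. The terms
in x_{wt} reassemble, by induction with centre t, into the summand for t. -/
theorem prod_gen_eq_sum {T : Finset (Fin (n + 1))} (hT : T.Nonempty) (w : Fin (n + 1)) :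
    ∏ i ∈ T, gen w i = ∑ v ∈ T, (∏ i ∈ T.erase v, gen v i) * gen w v := by
  induction hT using Finset.Nonempty.cons_induction generalizing w with
  | singleton t => simp
  | cons t T ht hT ih =>
    rw [prod_cons, sum_cons, ih w, cons_eq_insert, erase_insert ht, ih t, mul_sum, sum_mul,
      ← sum_add_distrib]
    refine sum_congr rfl fun v hv => ?_
    have hvt : t ≠ v := fun h => ht (h ▸ hv)
    rw [erase_insert_of_ne hvt, prod_insert (fun h => ht (mem_of_mem_erase h))]
    linear_combination (∏ i ∈ T.erase v, gen v i) * gen_mul_gen w v t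

/-- Recentring the star at w produces, by antisymmetry, the negatives of the stars at the other
vertices. -/
theorem sum_prod_erase_eq_zero {T : Finset (Fin (n + 1))} (hT : T.Nonempty) {w : Fin (n + 1)}
    (hw : w ∉ T) : ∑ v ∈ insert w T, ∏ i ∈ (insert w T).erase v, gen v i = 0 := by
  rw [sum_insert hw, erase_insert hw, prod_gen_eq_sum hT w, ← sum_add_distrib]
  refine sum_eq_zero fun v hv => ?_
  have hvw : w ≠ v := fun h => hw (h ▸ hv)
  rw [erase_insert_of_ne hvw, prod_insert (fun h => hw (mem_of_mem_erase h)), gen_swap w v]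
  ring

/-! ### Stars modulo coinvariants -/

/-- The kernel of the projection to coinvariants under the permutations supported on `D`. -/
noncomputable def coinvKer (D : Finset (Fin (n + 1))) : Submodule ℚ (VGBraid n) :=
  Submodule.span ℚ {a | ∃ (b : VGBraid n) (σ : Equiv.Perm (Fin (n + 1))),
    (∀ v ∉ D, σ v = v) ∧ a = b - σ • b}

theorem sub_smul_mem_coinvKer {D : Finset (Fin (n + 1))} {σ : Equiv.Perm (Fin (n + 1))}
    (hσ : ∀ v ∉ D, σ v = v) (b : VGBraid n) : b - σ • b ∈ coinvKer D :=
  Submodule.subset_span ⟨b, σ, hσ, rfl⟩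

theorem coinvKer_mono {D E : Finset (Fin (n + 1))} (h : D ⊆ E) :
    (coinvKer D : Submodule ℚ (VGBraid n)) ≤ coinvKer E := by
  refine Submodule.span_mono ?_
  rintro a ⟨b, σ, hσ, rfl⟩
  exact ⟨b, σ, fun v hv => hσ v fun h' => hv (h h'), rfl⟩

/-- If y is fixed by σ, then (b - σ • b) y = b y - σ • (b y). -/
theorem mul_mem_coinvKer {D : Finset (Fin (n + 1))} {y : VGBraid n}
    (hy : ∀ σ : Equiv.Perm (Fin (n + 1)), (∀ v ∉ D, σ v = v) → σ • y = y)
    {a : VGBraid n} (ha : a ∈ coinvKer D) : a * y ∈ coinvKer D := by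
  induction ha using Submodule.span_induction with
  | mem a ha =>
    obtain ⟨b, σ, hσ, rfl⟩ := ha
    have := sub_smul_mem_coinvKer hσ (b * y)
    rwa [smul_mul', hy σ hσ, ← sub_mul] at this
  | zero => simp
  | add a b _ _ ha hb => rw [add_mul]; exact add_mem ha hb
  | smul r a _ ha => rw [smul_mul_assoc]; exact Submodule.smul_mem _ r ha

theorem swap_apply_of_notMem {D : Finset (Fin (n + 1))} {i j : Fin (n + 1)} (hi : i ∈ D)
    (hj : j ∈ D) : ∀ v ∉ D, Equiv.swap i j v = v := fun _ hv =>
  Equiv.swap_apply_of_ne_of_ne (fun h => hv (h ▸ hi)) (fun h => hv (h ▸ hj))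

theorem smul_prod_gen (σ : Equiv.Perm (Fin (n + 1))) (v : Fin (n + 1))
    (S : Finset (Fin (n + 1))) :
    σ • ∏ i ∈ S, gen v i = ∏ i ∈ S.map σ.toEmbedding, gen (σ v) i := by
  rw [smul_prod', prod_map]
  exact prod_congr rfl fun i _ => smul_gen σ v i

theorem map_swap_erase {T : Finset (Fin (n + 1))} {v w : Fin (n + 1)} (hv : v ∈ T) (hw : w ∈ T) :
    (T.erase v).map (Equiv.swap v w).toEmbedding = T.erase w := by
  ext i
  simp only [mem_map_equiv, Equiv.symm_swap, mem_erase]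
  rcases eq_or_ne i v with rfl | h₁
  · simp only [Equiv.swap_apply_left]; tauto
  rcases eq_or_ne i w with rfl | h₂
  · simp
  · simp [Equiv.swap_apply_of_ne_of_ne h₁ h₂, h₁, h₂]

theorem prod_erase_sub_mem_coinvKer {D T : Finset (Fin (n + 1))} (hT : T ⊆ D)
    {v w : Fin (n + 1)} (hv : v ∈ T) (hw : w ∈ T) :
    ∏ i ∈ T.erase w, gen w i - ∏ i ∈ T.erase v, gen v i ∈ coinvKer D := by
  have := sub_smul_mem_coinvKer (swap_apply_of_notMem (hT hw) (hT hv))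
    (∏ i ∈ T.erase w, gen w i)
  rwa [smul_prod_gen, map_swap_erase hw hv, Equiv.swap_apply_left] at this

/-- Transpositions make all stars on `insert c S` congruent, and they sum to zero; divide by their
number. -/
theorem prod_gen_mem_coinvKer {D S : Finset (Fin (n + 1))} (hS : S.Nonempty) {c : Fin (n + 1)}
    (hc : c ∉ S) (hD : insert c S ⊆ D) : ∏ i ∈ S, gen c i ∈ coinvKer D := by
  set T := insert c S
  have hcT : c ∈ T := mem_insert_self c S
  have h : ∑ v ∈ T, (∏ i ∈ T.erase c, gen c i - ∏ i ∈ T.erase v, gen v i) ∈ coinvKer D :=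
    sum_mem fun v hv => prod_erase_sub_mem_coinvKer hD hv hcT
  rw [sum_sub_distrib, sum_prod_erase_eq_zero hS hc, sub_zero, erase_insert hc, sum_const,
    ← Nat.cast_smul_eq_nsmul ℚ] at h
  refine (Submodule.smul_mem_iff _ ?_).1 h
  exact_mod_cast (card_pos.2 ⟨c, hcT⟩).ne'

/-- The span of the products `∏_{i ∈ S} x_{ci}` with `S ⊆ D`. -/
noncomputable def starSpan (D : Finset (Fin (n + 1))) (c : Fin (n + 1)) : Submodule ℚ (VGBraid n) :=
  Submodule.span ℚ {a | ∃ S ⊆ D, a = ∏ i ∈ S, gen c i}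

theorem prod_gen_mem_starSpan {D S : Finset (Fin (n + 1))} (hS : S ⊆ D) (c : Fin (n + 1)) :
    ∏ i ∈ S, gen c i ∈ starSpan D c :=
  Submodule.subset_span ⟨S, hS, rfl⟩

/-- Attaching a star with centre `i` to `c` gives, up to coinvariants, a multiple of a star with
centre `c`. -/
theorem prod_gen_mul_gen_mem {D S : Finset (Fin (n + 1))} {c i : Fin (n + 1)} (hc : c ∉ D)
    (hi : i ∉ S) (hD : insert i S ⊆ D) :
    (∏ j ∈ S, gen i j) * gen c i ∈ coinvKer D ⊔ starSpan D c := by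
  set T := insert i S
  have hiT : i ∈ T := mem_insert_self i S
  -- Swapping i and v recentres the hung star and fixes c; summed over v, the hung stars form the
  -- star at c by `prod_gen_eq_sum`.
  have key : ∀ v ∈ T, (∏ j ∈ T.erase i, gen i j) * gen c i - (∏ j ∈ T.erase v, gen v j) * gen c v
      ∈ coinvKer D := by
    intro v hv
    have hsw := swap_apply_of_notMem (hD hiT) (hD hv)
    have := sub_smul_mem_coinvKer hsw ((∏ j ∈ T.erase i, gen i j) * gen c i)
    rwa [smul_mul', smul_prod_gen, map_swap_erase hiT hv, smul_gen, Equiv.swap_apply_left,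
      hsw c hc] at this
  have h := sum_mem key
  rw [sum_sub_distrib, ← prod_gen_eq_sum ⟨i, hiT⟩ c, erase_insert hi, sum_const,
    ← Nat.cast_smul_eq_nsmul ℚ] at h
  have h' := add_mem (Submodule.mem_sup_left (T := starSpan D c) h)
    (Submodule.mem_sup_right (prod_gen_mem_starSpan hD c))
  rw [sub_add_cancel] at h'
  refine (Submodule.smul_mem_iff _ ?_).1 h'
  exact_mod_cast (card_pos.2 ⟨i, hiT⟩).ne'

/-! ### Reduction of the whole ring to stars -/

/-- The subalgebra generated by the `x_{ij}` with `i, j ∈ T`. -/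
noncomputable def genAlg (T : Finset (Fin (n + 1))) : Subalgebra ℚ (VGBraid n) :=
  Algebra.adjoin ℚ {a | ∃ i ∈ T, ∃ j ∈ T, a = gen i j}

theorem gen_mem_genAlg {T : Finset (Fin (n + 1))} {i j : Fin (n + 1)} (hi : i ∈ T) (hj : j ∈ T) :
    gen i j ∈ genAlg T :=
  Algebra.subset_adjoin ⟨i, hi, j, hj, rfl⟩

theorem genAlg_univ : genAlg (univ : Finset (Fin (n + 1))) = ⊤ := by
  rw [eq_top_iff]
  rintro a -
  obtain ⟨f, rfl⟩ := mk_surjective n a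
  induction f using MvPolynomial.induction_on with
  | C r => exact (genAlg univ).algebraMap_mem r
  | add p q hp hq => rw [map_add]; exact add_mem hp hq
  | mul_X p q hp =>
    rw [map_mul]
    refine mul_mem hp ?_
    have := gen_mem_genAlg (mem_univ q.1.1) (mem_univ q.1.2)
    rwa [gen_of_ne q.2] at this

theorem genAlg_empty : (genAlg ∅ : Subalgebra ℚ (VGBraid n)) = ⊥ := by
  simp [genAlg]

/-- The span of `1` and the `x_{ci}` with `i ∈ D`. -/
noncomputable def linSpan (D : Finset (Fin (n + 1))) (c : Fin (n + 1)) : Submodule ℚ (VGBraid n) :=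
  Submodule.span ℚ {a | a = 1 ∨ ∃ i ∈ D, a = gen c i}

/-- The identity x_{cj} x_{ci} = x_{cj} x_{ji} + x_{ci} x_{ij} trades two edges at c for one edge at
c and one inside D. -/
theorem gen_mul_mem {D : Finset (Fin (n + 1))} {c j : Fin (n + 1)} (hj : j ∈ D) {m : VGBraid n}
    (hm : m ∈ Subalgebra.toSubmodule (genAlg D) * linSpan D c) :
    gen c j * m ∈ Subalgebra.toSubmodule (genAlg D) * linSpan D c := by
  have hgen : ∀ i ∈ D, gen c i ∈ linSpan D c := fun i hi => Submodule.subset_span (.inr ⟨i, hi, rfl⟩)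
  refine Submodule.mul_induction_on hm (fun f hf y hy => ?_) fun a b ha hb => ?_
  · induction hy using Submodule.span_induction with
    | zero => simp
    | add a b _ _ ha hb => rw [mul_add, mul_add]; exact add_mem ha hb
    | smul r a _ ha => rw [mul_smul_comm, mul_smul_comm]; exact Submodule.smul_mem _ r ha
    | mem y hy =>
      rcases hy with rfl | ⟨i, hi, rfl⟩
      · rw [mul_one, mul_comm (gen c j) f]
        exact Submodule.mul_mem_mul hf (hgen j hj)
      · have h : gen c j * (f * gen c i) =
            f * gen j i * gen c j + f * gen i j * gen c i := by
          linear_combination f * gen_mul_gen c j i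
        rw [h]
        exact add_mem
          (Submodule.mul_mem_mul ((genAlg D).mul_mem hf (gen_mem_genAlg hj hi)) (hgen j hj))
          (Submodule.mul_mem_mul ((genAlg D).mul_mem hf (gen_mem_genAlg hi hj)) (hgen i hi))
  · rw [mul_add]; exact add_mem ha hb

theorem genAlg_insert_le (D : Finset (Fin (n + 1))) (c : Fin (n + 1)) :
    Subalgebra.toSubmodule (genAlg (insert c D)) ≤
      Subalgebra.toSubmodule (genAlg D) * linSpan D c := by
  intro a ha
  suffices h : ∀ m ∈ Subalgebra.toSubmodule (genAlg D) * linSpan D c,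
      a * m ∈ Subalgebra.toSubmodule (genAlg D) * linSpan D c by
    have h1 : (1 : VGBraid n) ∈ Subalgebra.toSubmodule (genAlg D) * linSpan D c := by
      have h₁ : (1 : VGBraid n) ∈ Subalgebra.toSubmodule (genAlg D) := one_mem (genAlg D)
      have h₂ : (1 : VGBraid n) ∈ linSpan D c := Submodule.subset_span (.inl rfl)
      simpa using Submodule.mul_mem_mul h₁ h₂
    simpa using h 1 h1
  rw [Subalgebra.mem_toSubmodule] at ha
  induction ha using Algebra.adjoin_induction with
  | algebraMap r =>
    intro m hm
    rw [← Algebra.smul_def]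
    exact Submodule.smul_mem _ r hm
  | add a b _ _ ha hb => intro m hm; rw [add_mul]; exact add_mem (ha m hm) (hb m hm)
  | mul a b _ _ ha hb => intro m hm; rw [mul_assoc]; exact ha _ (hb m hm)
  | mem a ha =>
    obtain ⟨i, hi, j, hj, rfl⟩ := ha
    intro m hm
    rcases mem_insert.1 hi with rfl | hi'
    · rcases mem_insert.1 hj with rfl | hj'
      · simp
      · exact gen_mul_mem hj' hm
    · rcases mem_insert.1 hj with rfl | hj'
      · rw [gen_swap j i, neg_mul]
        exact neg_mem (gen_mul_mem hi' hm)
      · refine Submodule.mul_induction_on hm (fun f hf y hy => ?_) fun a b ha hb => ?_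
        · rw [← mul_assoc (gen i j) f y]
          exact Submodule.mul_mem_mul ((genAlg D).mul_mem (gen_mem_genAlg hi' hj') hf) hy
        · rw [mul_add]; exact add_mem ha hb

/-- Once permutations may also move c, nonempty stars vanish and only scalars survive. -/
theorem genAlg_le_of_genAlg_insert_le {D : Finset (Fin (n + 1))} {c : Fin (n + 1)} (hc : c ∉ D)
    (h : Subalgebra.toSubmodule (genAlg (insert c D)) ≤ coinvKer D ⊔ starSpan D c) :
    Subalgebra.toSubmodule (genAlg (insert c D)) ≤
      coinvKer (insert c D) ⊔ Submodule.span ℚ {1} := by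
  refine h.trans (sup_le ((coinvKer_mono (subset_insert c D)).trans le_sup_left) ?_)
  refine Submodule.span_le.2 ?_
  rintro a ⟨S, hS, rfl⟩
  rcases S.eq_empty_or_nonempty with rfl | hne
  · rw [prod_empty]
    exact Submodule.mem_sup_right (Submodule.mem_span_singleton_self 1)
  · exact Submodule.mem_sup_left
      (prod_gen_mem_coinvKer hne (fun h => hc (hS h)) (insert_subset_insert c hS))

theorem genAlg_insert_le_coinvKer_sup (D : Finset (Fin (n + 1))) (c : Fin (n + 1)) (hc : c ∉ D) :
    Subalgebra.toSubmodule (genAlg (insert c D)) ≤ coinvKer D ⊔ starSpan D c := by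
  induction D using Finset.strongInduction generalizing c with
  | H D ih =>
    have ih' : ∀ i ∈ D, Subalgebra.toSubmodule (genAlg D) ≤
        coinvKer (D.erase i) ⊔ starSpan (D.erase i) i := fun i hi => by
      have := ih (D.erase i) (erase_ssubset hi) i (notMem_erase i D)
      rwa [insert_erase hi] at this
    have hone : Subalgebra.toSubmodule (genAlg D) ≤ coinvKer D ⊔ Submodule.span ℚ {1} := by
      rcases D.eq_empty_or_nonempty with rfl | ⟨i, hi⟩
      · rw [genAlg_empty, Algebra.toSubmodule_bot, Submodule.one_eq_span]
        exact le_sup_right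
      · have := genAlg_le_of_genAlg_insert_le (notMem_erase i D)
          (ih (D.erase i) (erase_ssubset hi) i (notMem_erase i D))
        rwa [insert_erase hi] at this
    refine (genAlg_insert_le D c).trans (Submodule.mul_le.2 fun f hf y hy => ?_)
    induction hy using Submodule.span_induction with
    | zero => simp
    | add a b _ _ ha hb => rw [mul_add]; exact add_mem ha hb
    | smul r a _ ha => rw [mul_smul_comm]; exact Submodule.smul_mem _ r ha
    | mem y hy =>
      rcases hy with rfl | ⟨i, hi, rfl⟩
      · rw [mul_one]
        have h1 : Submodule.span ℚ {1} ≤ starSpan D c := by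
          rw [Submodule.span_singleton_le_iff_mem]
          simpa using prod_gen_mem_starSpan (empty_subset D) c
        exact (sup_le_sup le_rfl h1) (hone hf)
      -- Reduce f to stars at i using only permutations of D \ {i}: these fix x_{ci}, so the
      -- reduction survives multiplication by it and leaves stars at i hung from c.
      · obtain ⟨u, hu, s, hs, rfl⟩ := Submodule.mem_sup.1 (ih' i hi hf)
        rw [add_mul]
        refine add_mem (Submodule.mem_sup_left (coinvKer_mono (erase_subset i D) ?_)) ?_
        · refine mul_mem_coinvKer (fun σ hσ => ?_) hu
          rw [smul_gen, hσ i (notMem_erase i D), hσ c fun h => hc (mem_of_mem_erase h)]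
        · clear hf
          induction hs using Submodule.span_induction with
          | zero => simp
          | add a b _ _ ha hb => rw [add_mul]; exact add_mem ha hb
          | smul r a _ ha => rw [smul_mul_assoc]; exact Submodule.smul_mem _ r ha
          | mem a ha =>
            obtain ⟨S, hS, rfl⟩ := ha
            exact prod_gen_mul_gen_mem hc (fun h => notMem_erase i D (hS h))
              (insert_subset hi (hS.trans (erase_subset i D)))

/-! ### The orbit sum generates the invariants -/

theorem orbitSum_eq_sum_gen (c : Fin (n + 1)) :
    orbitSum n c = ∑ i ∈ univ.erase c, gen c i := by
  have h (i : {i // i ≠ c}) : x c i i.2.symm = gen c i := (dif_pos i.2.symm).symm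
  simp only [orbitSum, h]
  exact (sum_subtype _ (by simp) _).symm

theorem smul_orbitSum (σ : Equiv.Perm (Fin (n + 1))) (c : Fin (n + 1)) :
    σ • orbitSum n c = orbitSum n (σ c) := by
  rw [orbitSum_eq_sum_gen, orbitSum_eq_sum_gen, smul_sum]
  refine sum_equiv σ (fun i => ?_) fun i _ => smul_gen σ c i
  simp

theorem smul_orbitSum_of_apply_eq {c : Fin (n + 1)} {σ : Equiv.Perm (Fin (n + 1))}
    (hσ : σ c = c) : σ • orbitSum n c = orbitSum n c := by
  rw [smul_orbitSum, hσ]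

theorem apply_eq_of_fixes {c : Fin (n + 1)} {σ : Equiv.Perm (Fin (n + 1))}
    (hσ : ∀ v ∉ univ.erase c, σ v = v) : σ c = c :=
  hσ c (notMem_erase c univ)

/-- Multiplying the star on S by z gives the sum of the stars on S ∪ {k} over the unused k, since
repeated edges square to zero. These are conjugate, so each is congruent to the product divided by
the number of unused k. -/
theorem exists_prod_gen_sub_smul_pow_mem {c : Fin (n + 1)} {S : Finset (Fin (n + 1))}
    (hS : S ⊆ univ.erase c) :
    ∃ q : ℚ, ∏ i ∈ S, gen c i - q • orbitSum n c ^ #S ∈ coinvKer (univ.erase c) := by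
  induction S using Finset.induction_on with
  | empty => exact ⟨1, by simp⟩
  | insert i S hi ih =>
    obtain ⟨q, hq⟩ := ih ((subset_insert i S).trans hS)
    have hz : (∏ j ∈ S, gen c j) * orbitSum n c =
        ∑ k ∈ (univ.erase c) \ S, ∏ j ∈ insert k S, gen c j := by
      rw [orbitSum_eq_sum_gen, mul_sum, ← sum_sdiff ((subset_insert i S).trans hS)]
      have h0 : ∑ k ∈ S, (∏ j ∈ S, gen c j) * gen c k = 0 := sum_eq_zero fun k hk => by
        rw [← mul_prod_erase S _ hk]
        linear_combination (∏ j ∈ S.erase k, gen c j) * gen_sq c k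
      rw [h0, add_zero]
      refine sum_congr rfl fun k hk => ?_
      rw [prod_insert (mem_sdiff.1 hk).2, mul_comm]
    have hiD : i ∈ univ.erase c := hS (mem_insert_self i S)
    have hdiff : ∀ k ∈ (univ.erase c) \ S,
        ∏ j ∈ insert i S, gen c j - ∏ j ∈ insert k S, gen c j ∈ coinvKer (univ.erase c) := by
      intro k hk
      rw [mem_sdiff] at hk
      have hsw := swap_apply_of_notMem hiD hk.1
      have := sub_smul_mem_coinvKer hsw (∏ j ∈ insert i S, gen c j)
      rw [smul_prod_gen, apply_eq_of_fixes hsw, map_insert] at this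
      have hS' : S.map (Equiv.swap i k).toEmbedding = S := by
        rw [map_eq_image]
        refine (image_congr fun j hj => ?_).trans image_id
        exact Equiv.swap_apply_of_ne_of_ne (fun h => hi (h ▸ hj)) (fun h => hk.2 (h ▸ hj))
      rwa [hS', Equiv.coe_toEmbedding, Equiv.swap_apply_left] at this
    have hsum := sum_mem hdiff
    rw [sum_sub_distrib, ← hz, sum_const, ← Nat.cast_smul_eq_nsmul ℚ] at hsum
    have hq' := mul_mem_coinvKer
      (fun σ hσ => smul_orbitSum_of_apply_eq (apply_eq_of_fixes hσ)) hq
    have hcard : (#((univ.erase c) \ S) : ℚ) ≠ 0 :=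
      Nat.cast_ne_zero.2 (card_pos.2 ⟨i, mem_sdiff.2 ⟨hiD, hi⟩⟩).ne'
    refine ⟨(#((univ.erase c) \ S) : ℚ)⁻¹ * q, ?_⟩
    have := Submodule.smul_mem _ (#((univ.erase c) \ S) : ℚ)⁻¹ (add_mem hsum hq')
    convert this using 1
    rw [sub_mul, sub_add_sub_cancel, smul_sub, inv_smul_smul₀ hcard, card_insert_of_notMem hi,
      pow_succ, smul_mul_assoc, smul_smul]

theorem exists_sub_aeval_mem_coinvKer (c : Fin (n + 1)) (a : VGBraid n) :
    ∃ p : ℚ[X], a - aeval (orbitSum n c) p ∈ coinvKer (univ.erase c) := by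
  have ha : a ∈ Subalgebra.toSubmodule (genAlg (insert c (univ.erase c))) := by
    rw [insert_erase (mem_univ c), genAlg_univ]; trivial
  obtain ⟨u, hu, s, hs, rfl⟩ := Submodule.mem_sup.1
    (genAlg_insert_le_coinvKer_sup _ c (notMem_erase c univ) ha)
  suffices h : ∃ p : ℚ[X], s - aeval (orbitSum n c) p ∈ coinvKer (univ.erase c) by
    obtain ⟨p, hp⟩ := h
    exact ⟨p, by rw [add_sub_assoc]; exact add_mem hu hp⟩
  clear ha
  induction hs using Submodule.span_induction with
  | zero => exact ⟨0, by simp⟩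
  | add a b _ _ ha hb =>
    obtain ⟨p, hp⟩ := ha
    obtain ⟨q, hq⟩ := hb
    exact ⟨p + q, by rw [map_add, add_sub_add_comm]; exact add_mem hp hq⟩
  | smul r a _ ha =>
    obtain ⟨p, hp⟩ := ha
    exact ⟨r • p, by rw [map_smul, ← smul_sub]; exact Submodule.smul_mem _ r hp⟩
  | mem a ha =>
    obtain ⟨S, hS, rfl⟩ := ha
    obtain ⟨q, hq⟩ := exists_prod_gen_sub_smul_pow_mem hS
    exact ⟨q • X ^ #S, by simpa using hq⟩

theorem mem_range_aeval_of_mem_invariants {c : Fin (n + 1)} {a : VGBraid n}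
    (ha : a ∈ invariants n c) : ∃ p : ℚ[X], aeval (orbitSum n c) p = a := by
  classical
  obtain ⟨p, hp⟩ := exists_sub_aeval_mem_coinvKer c a
  refine ⟨p, ?_⟩
  have hpinv : aeval (orbitSum n c) p ∈ invariants n c := by
    have hz : orbitSum n c ∈ invariants n c := fun σ hσ => smul_orbitSum_of_apply_eq hσ
    exact Polynomial.aeval_mem_adjoin_singleton ℚ _ |> (Algebra.adjoin_le (by simpa using hz) ·)
  -- The group sum kills every b - τ • b by reindexing, but multiplies the invariant a - p(z) by the
  -- group order.
  have hR : ∀ u ∈ coinvKer (univ.erase c),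
      ∑ σ : MulAction.stabilizer (Equiv.Perm (Fin (n + 1))) c, σ • (u : VGBraid n) = 0 := by
    intro u hu
    induction hu using Submodule.span_induction with
    | zero => simp
    | add a b _ _ ha hb => simp only [smul_add, sum_add_distrib, ha, hb, add_zero]
    | smul r a _ ha =>
      have : ∀ σ : MulAction.stabilizer (Equiv.Perm (Fin (n + 1))) c,
        σ • (r • a) = r • σ • a := fun σ => smul_algebraMap_smul σ.1 r a
      simp only [this, ← smul_sum, ha, smul_zero]
    | mem u hu =>
      obtain ⟨b, τ, hτ, rfl⟩ := hu
      have hτ' : τ ∈ MulAction.stabilizer (Equiv.Perm (Fin (n + 1))) c := apply_eq_of_fixes hτ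
      simp only [smul_sub, sum_sub_distrib, sub_eq_zero]
      refine (Fintype.sum_equiv (Equiv.mulRight ⟨τ, hτ'⟩) _ _ fun σ => ?_).symm
      exact (mul_smul σ.1 τ b).symm
  have h := hR _ hp
  have hinv : ∀ σ : MulAction.stabilizer (Equiv.Perm (Fin (n + 1))) c,
      σ • (a - aeval (orbitSum n c) p) = a - aeval (orbitSum n c) p :=
    fun σ => (sub_mem ha hpinv) σ.1 σ.2
  simp only [hinv, sum_const, ← Nat.cast_smul_eq_nsmul ℚ] at h
  have := (smul_eq_zero.1 h).resolve_left (Nat.cast_ne_zero.2 (card_pos.2 ⟨1, mem_univ _⟩).ne')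
  exact (sub_eq_zero.1 this).symm

/-! ### Powers of the orbit sum and the kernel -/

theorem add_pow_succ_of_sq_eq_zero {R : Type*} [CommRing R] (a : R) {y : R} (hy : y ^ 2 = 0)
    (k : ℕ) : (y + a) ^ (k + 1) = a ^ (k + 1) + (k + 1) * a ^ k * y := by
  induction k with
  | zero => simp [add_comm]
  | succ k ih =>
    rw [pow_succ, ih]
    push_cast
    linear_combination (k + 1) * a ^ k * hy

theorem sum_pow_card_of_sq_eq_zero {R ι : Type*} [CommRing R] [DecidableEq ι] {y : ι → R}
    (hy : ∀ i, y i ^ 2 = 0) (S : Finset ι) :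
    (∑ i ∈ S, y i) ^ (#S + 1) = 0 ∧ (∑ i ∈ S, y i) ^ #S = (#S).factorial * ∏ i ∈ S, y i := by
  induction S using Finset.induction_on with
  | empty => simp
  | insert i S hi ih =>
    rw [sum_insert hi, prod_insert hi, card_insert_of_notMem hi,
      add_pow_succ_of_sq_eq_zero _ (hy i), add_pow_succ_of_sq_eq_zero _ (hy i), pow_succ _ (#S + 1),
      ih.1, ih.2, Nat.factorial_succ]
    constructor
    · ring
    · push_cast; ring

theorem orbitSum_pow_succ (c : Fin (n + 1)) : orbitSum n c ^ (n + 1) = 0 := by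
  have := (sum_pow_card_of_sq_eq_zero (gen_sq c) (univ.erase c)).1
  rwa [← orbitSum_eq_sum_gen, card_erase_of_mem (mem_univ c), card_univ, Fintype.card_fin,
    Nat.add_sub_cancel] at this

theorem orbitSum_pow (c : Fin (n + 1)) :
    orbitSum n c ^ n = n.factorial * ∏ i ∈ univ.erase c, gen c i := by
  have := (sum_pow_card_of_sq_eq_zero (gen_sq c) (univ.erase c)).2
  rwa [← orbitSum_eq_sum_gen, card_erase_of_mem (mem_univ c), card_univ, Fintype.card_fin,
    Nat.add_sub_cancel] at this

/-- Commuting square-zero elements `y i` define a homomorphism sending `x_{ij}` to `y_j` for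
`i < j`. -/
theorem exists_algHom_of_sq_eq_zero {R : Type*} [CommRing R] [Algebra ℚ R]
    {y : Fin (n + 1) → R} (hy : ∀ i, y i ^ 2 = 0) :
    ∃ φ : VGBraid n →ₐ[ℚ] R, ∀ i j, i < j → φ (gen i j) = y j := by
  let g : Fin (n + 1) → Fin (n + 1) → R := fun i j => if i < j then y j else -y i
  have hg : ∀ i j (h : i ≠ j),
      MvPolynomial.aeval (fun p : BraidIndex n => g p.1.1 p.1.2) (var i j h) = g i j :=
    fun i j h => by simp [var]
  have hker : ∀ a ∈ relIdeal n,
      MvPolynomial.aeval (fun p : BraidIndex n => g p.1.1 p.1.2) a = 0 := by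
    intro a ha
    have hle : relIdeal n ≤
        RingHom.ker (MvPolynomial.aeval (R := ℚ) (fun p : BraidIndex n => g p.1.1 p.1.2)) := by
      refine Ideal.span_le.2 fun f hf => ?_
      change MvPolynomial.aeval (fun p : BraidIndex n => g p.1.1 p.1.2) f = 0
      cases hf with
      | sq i j h =>
        rw [map_pow, hg]
        by_cases hij : i < j <;> simp [g, hij, hy]
      | antisymm i j h =>
        rw [map_add, hg, hg]
        rcases lt_or_gt_of_ne h with h | h <;> simp [g, h, h.not_gt]
      -- In each possible ordering the expression collapses to minus the square of the y with
      -- largest index; the cyclic orderings are contradictory.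
      | triangle i j k hij hjk hki =>
        simp only [map_add, map_mul, hg]
        have h₁ := hy i
        have h₂ := hy j
        have h₃ := hy k
        rcases lt_or_gt_of_ne hij with h | h <;> rcases lt_or_gt_of_ne hjk with h' | h' <;>
          rcases lt_or_gt_of_ne hki with h'' | h'' <;>
          simp only [g, h, h', h'', h.not_gt, h'.not_gt, h''.not_gt, if_true, if_false] <;>
          first
          | (exfalso; order)
          | linear_combination -h₁
          | linear_combination -h₂
          | linear_combination -h₃
    exact hle ha
  refine ⟨Ideal.Quotient.liftₐ (relIdeal n) _ hker, fun i j hij => ?_⟩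
  rw [gen_of_ne hij.ne]
  change MvPolynomial.aeval (fun p : BraidIndex n => g p.1.1 p.1.2) (var i j hij.ne) = y j
  rw [hg]
  exact if_pos hij

/-- Quotient by the monomial ideal of the squares: no X_i^2 divides the squarefree monomial ∏ X_i.
-/
theorem exists_sq_eq_zero_prod_ne_zero (ι : Type) [Fintype ι] :
    ∃ (R : Type) (_ : CommRing R) (_ : Algebra ℚ R) (y : ι → R),
      (∀ i, y i ^ 2 = 0) ∧ ∏ i, y i ≠ 0 := by
  classical
  let I : Ideal (MvPolynomial ι ℚ) :=
    Ideal.span ((fun s => MvPolynomial.monomial s (1 : ℚ)) '' {s | ∃ i, s = Finsupp.single i 2})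
  refine ⟨MvPolynomial ι ℚ ⧸ I, inferInstance, inferInstance,
    fun i => Ideal.Quotient.mk I (MvPolynomial.X i), fun i => ?_, ?_⟩
  · rw [← map_pow, Ideal.Quotient.eq_zero_iff_mem, MvPolynomial.X_pow_eq_monomial]
    exact Ideal.subset_span ⟨_, ⟨i, rfl⟩, rfl⟩
  · rw [← map_prod, Ne, Ideal.Quotient.eq_zero_iff_mem, MvPolynomial.mem_ideal_span_monomial_image]
    have hX : ∏ i : ι, (MvPolynomial.X i : MvPolynomial ι ℚ) =
        MvPolynomial.monomial (Finsupp.equivFunOnFinite.symm fun _ => 1) 1 := by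
      rw [MvPolynomial.monomial_eq, Finsupp.prod_fintype _ _ (by simp)]
      simp
    rw [hX]
    intro h
    obtain ⟨_, ⟨i, rfl⟩, hi⟩ := h (Finsupp.equivFunOnFinite.symm fun _ => 1) (by
      rw [MvPolynomial.mem_support_iff, MvPolynomial.coeff_monomial, if_pos rfl]
      exact one_ne_zero)
    have := hi i
    simp at this

/-- Centre 0 is the least index, so each x_{0i} maps to y_i without a sign; other centres follow by
conjugation. -/
theorem orbitSum_zero_pow_ne_zero : orbitSum n 0 ^ n ≠ 0 := by
  obtain ⟨R, _, _, y, hy, hne⟩ := exists_sq_eq_zero_prod_ne_zero (Fin (n + 1))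
  obtain ⟨φ, hφ⟩ := exists_algHom_of_sq_eq_zero hy
  intro h
  rw [orbitSum_pow] at h
  have h' := congrArg φ h
  rw [map_mul, map_natCast, map_prod, map_zero] at h'
  rw [prod_congr rfl fun i hi => hφ 0 i (Fin.pos_of_ne_zero (ne_of_mem_erase hi))] at h'
  apply hne
  rw [← mul_prod_erase univ y (mem_univ 0)]
  have h2 : (n.factorial : ℚ) • ∏ i ∈ univ.erase 0, y i = 0 := by
    rw [Nat.cast_smul_eq_nsmul, nsmul_eq_mul]; exact h'
  rw [(smul_eq_zero.1 h2).resolve_left (Nat.cast_ne_zero.2 n.factorial_ne_zero), mul_zero]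

theorem orbitSum_pow_ne_zero (c : Fin (n + 1)) : orbitSum n c ^ n ≠ 0 := by
  intro h
  have := congrArg (Equiv.swap c 0 • ·) h
  simp only [smul_pow', smul_orbitSum, Equiv.swap_apply_left, smul_zero] at this
  exact orbitSum_zero_pow_ne_zero this

/-- The kernel is principal and its generator divides X^(n+1), hence is associated to some X^k;
nonvanishing of z^n forces k = n + 1. -/
theorem ker_aeval_orbitSum (c : Fin (n + 1)) :
    RingHom.ker (aeval (R := ℚ) (orbitSum n c)) = Ideal.span {X ^ (n + 1)} := by
  have h0 : aeval (orbitSum n c) ((X : ℚ[X]) ^ (n + 1)) = 0 := by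
    simp [orbitSum_pow_succ]
  refine le_antisymm (fun p hp => ?_) ?_
  · obtain ⟨q, hq⟩ := (IsPrincipalIdealRing.principal
      (RingHom.ker (aeval (R := ℚ) (orbitSum n c)))).principal
    have hX : (X : ℚ[X]) ^ (n + 1) ∈ Ideal.span {q} := hq.le h0
    have hp' : p ∈ Ideal.span {q} := hq.le hp
    have hq0 : aeval (orbitSum n c) q = 0 := by
      change q ∈ RingHom.ker (aeval (R := ℚ) (orbitSum n c))
      rw [hq]; exact Submodule.mem_span_singleton_self q
    rw [Ideal.mem_span_singleton] at hX hp' ⊢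
    obtain ⟨k, hk, hassoc⟩ := (dvd_prime_pow prime_X (n + 1)).1 hX
    have hXk : orbitSum n c ^ k = 0 := by
      obtain ⟨r, hr⟩ := hassoc.dvd
      have := congrArg (aeval (orbitSum n c)) hr
      simpa [hq0] using this
    have hk' : k = n + 1 := by
      by_contra hne
      exact orbitSum_pow_ne_zero c (pow_eq_zero_of_le (by omega) hXk)
    subst hk'
    exact hassoc.dvd'.trans hp'
  · rw [Ideal.span_singleton_le_iff_mem]
    exact h0

end VGBraid

/-- For `n ≥ 2`, the invariant subring of the Varchenko–Gel'fand ring of the braid arrangement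
`A_n` under the copy of `S_n` fixing one coordinate `c` (for instance the last one, or the first
one) is isomorphic to `ℚ[z] / (z ^ (n + 1))`, the class of `z` corresponding to
`∑_{i ≠ c} x_{ci}`. -/
theorem theorem1 (n : ℕ) (hn : 2 ≤ n) (c : Fin (n + 1)) :
    ∃ e : (ℚ[X] ⧸ Ideal.span {(X : ℚ[X]) ^ (n + 1)}) ≃ₐ[ℚ] VGBraid.invariants n c,
      (e (Ideal.Quotient.mk (Ideal.span {(X : ℚ[X]) ^ (n + 1)}) X) : VGBraid n) =
        VGBraid.orbitSum n c := by
  have hz : VGBraid.orbitSum n c ∈ VGBraid.invariants n c :=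
    fun σ hσ => VGBraid.smul_orbitSum_of_apply_eq hσ
  let z : VGBraid.invariants n c := ⟨VGBraid.orbitSum n c, hz⟩
  have hval : ∀ p : ℚ[X], (aeval z p : VGBraid n) = aeval (VGBraid.orbitSum n c) p :=
    fun p => (aeval_algHom_apply (VGBraid.invariants n c).val z p).symm
  have hker : RingHom.ker (aeval (R := ℚ) z) = Ideal.span {(X : ℚ[X]) ^ (n + 1)} := by
    rw [← VGBraid.ker_aeval_orbitSum c]
    ext p
    rw [RingHom.mem_ker, RingHom.mem_ker, ← hval, ZeroMemClass.coe_eq_zero]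
  have hsurj : Function.Surjective (aeval (R := ℚ) z) := by
    rintro ⟨a, ha⟩
    obtain ⟨p, hp⟩ := VGBraid.mem_range_aeval_of_mem_invariants ha
    exact ⟨p, Subtype.ext ((hval p).trans hp)⟩
  refine ⟨(Ideal.quotientEquivAlgOfEq ℚ hker.symm).trans
    (Ideal.quotientKerAlgEquivOfSurjective hsurj), ?_⟩
  change (aeval z (X : ℚ[X]) : VGBraid n) = _
  rw [aeval_X]
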